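/- **Setting.** Let $k\ge 0$ and $r,q\ge 1$ be integers with $(k,r)\neq(0,1)$. On the bosonic Fock space $\mathbb{Q}[p_1,p_2,\dots]$ let $J_n=n\,\partial/\partial p_n$ and $J_{-n}=p_n\cdot$ for $n\ge 1$, write $\varsigma(u)=2\sinh(u/2)$, and let $\langle T\rangle$ be the constant term of $T(1)$. The $k$-leaky $r$-completed cycles cut-and-join operator is $$\mathcal F_r^k = r!\,[u^r z^{-k}]\ \frac{1}{\varsigma(u)}\exp\Big(\sum_{j\ge1}\varsigma(uj)\frac{J_{-j}}{j}z^{-j}\Big)\exp\Big(\sum_{j\ge1}\varsigma(uj)\frac{J_{j}}{j}z^{j}\Big).$$ For $b\ge 0$ put $m=(q(r-1)+k)b+q$ and $n=b(r-1)+1$. The one-part genus-$0$ $q$-orbifold $k$-leaky $r$-completed cycles Hurwitz number is $$\mathrm{lh}_{0;(m)}^{k,r,q}=\frac{1}{n!}\Big\langle \frac{J_m}{m}\Big(\frac{\mathcal F_r^k}{r}\Big)^{b}\Big(\frac{J_{-q}}{q}\Big)^{n}\Big\rangle ,$$ and $\mathrm{lh}_{0;(m)}^{k,r,q}=0$ for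 $m$ not of this form (the relation between $m$ and $b$ is the Riemann–Hurwitz condition in genus $0$; $b$ and $m$ determine each other). Define the formal power series $$W_{0,1}(X)=\sum_{m\ge0}\frac{\mathrm{lh}_{0;(m)}^{k,r,q}}{b!}X^m,\qquad Y(X)=\frac{dW_{0,1}(X)}{dX}\in\mathbb{Q}[[X]].$$ **Proposition.** Let $g=\gcd(qr,k)$, $\rho=qr/g$, $\kappa=k/g$. Then $Y\neq0$, and in $\mathbb{Q}[[X]]$ $$X^{(q-1)\kappa}=Y^{\kappa}\Big(1-\frac kr\,Y^{r-1}X^{r-1+k}\Big)^{\rho+\kappa}.$$ Moreover the differentials $dY$ and $dX$ are related by $$\big(1-(q(r-1)+k)\,Y^{r-1}X^{r-1+k}\big)\frac{dY}{Y}=\Big((q-1)+\frac{(q(r-1)+k)(r+k)}{r}\,Y^{r-1}X^{r-1+k}\Big)\frac{dX}{X},$$ that is, $$\big(1-(q(r-1)+k)\,Y^{r-1}X^{r-1+k}\big)\,X\,Y'(X)=\Big((q-1)+\frac{(q(r-1)+k)(r+k)}{r}\,Y^{r-1}X^{r-1+k}\Big)\,Y .$$ -/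

import Mathlib

open PowerSeries

noncomputable section

namespace LeakyHurwitz

/-- The charge-zero bosonic Fock space: polynomials in the power sums `p_1, p_2, …`. All matrix
elements used below are rational, so the coefficients are taken in `ℚ`. -/
abbrev Fock : Type := MvPolynomial ℕ+ ℚ

/-- The Heisenberg operators: `J_n = n ∂/∂p_n` and `J_{-n}` is multiplication by `p_n`, for `n > 0`.
The value `J_0 = 0` (total charge zero) is never used. -/
def J (n : ℤ) : Module.End ℚ Fock :=
  if 0 < n then (n : ℚ) • (MvPolynomial.pderiv n.toNat.toPNat').toLinearMap
  else if n < 0 then LinearMap.mulLeft ℚ (MvPolynomial.X (-n).toNat.toPNat')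
  else 0

/-- `J_{s_1} J_{s_2} ⋯` over the entries of a finite multiset of positive integers. -/
def annihilators (s : Multiset ℕ) : Module.End ℚ Fock :=
  ((s.sort (· ≤ ·)).map fun i : ℕ => J (i : ℤ)).prod

/-- `J_{-s_1} J_{-s_2} ⋯` over the entries of a finite multiset of positive integers. -/
def creators (s : Multiset ℕ) : Module.End ℚ Fock :=
  ((s.sort (· ≤ ·)).map fun i : ℕ => J (-(i : ℤ))).prod

/-- The vacuum expectation value `⟨T⟩ = ⟨0| T |0⟩`: apply `T` to `1`, then set all `p_i = 0`. -/
def vev (T : Module.End ℚ Fock) : ℚ := MvPolynomial.constantCoeff (T 1)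

/-- The order of the automorphism group of a multiset, `∏ (multiplicity)!`. -/
def autCard (s : Multiset ℕ) : ℕ := ∏ i ∈ s.toFinset, (s.count i).factorial

/-- `ς(a u) = 2 sinh (a u / 2) = e^{au/2} - e^{-au/2}`, as a power series in `u`. -/
def varsigma (a : ℚ) : ℚ⟦X⟧ := rescale (a / 2) (exp ℚ) - rescale (-(a / 2)) (exp ℚ)

/-- `𝒮(u) = ς(u) / u`, a power series with constant term `1`. -/
def calS : ℚ⟦X⟧ := PowerSeries.mk fun n => coeff (n + 1) (varsigma 1)

/-- For finite multisets `α`, `β` of positive integers, `r! [u^r]` of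
`1 / (|Aut α| |Aut β| ς(u)) · ∏ ς(α_i u) / α_i · ∏ ς(β_j u) / β_j`.
Since `1 / ς(u) = u⁻¹ 𝒮(u)⁻¹`, this is a coefficient of `u^{r+1}`. -/
def cutJoinCoeff (r : ℕ) (α β : Multiset ℕ) : ℚ :=
  (r.factorial : ℚ) / ((autCard α : ℚ) * (autCard β : ℚ)) *
    coeff (r + 1) (calS⁻¹ *
      (α.map fun i : ℕ => PowerSeries.C (1 / (i : ℚ)) * varsigma (i : ℚ)).prod *
      (β.map fun i : ℕ => PowerSeries.C (1 / (i : ℚ)) * varsigma (i : ℚ)).prod)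

/-- The part of the cut-and-join operator that annihilates total weight `N` and creates `N + k`. -/
def cutJoinPart (k r N : ℕ) : Module.End ℚ Fock :=
  ∑ α : Nat.Partition (N + k), ∑ β : Nat.Partition N,
    cutJoinCoeff r α.parts β.parts • (creators α.parts * annihilators β.parts)

/-- The weight `∑ i · (exponent of p_i)` of a monomial. -/
def weight (s : ℕ+ →₀ ℕ) : ℕ := s.sum fun i e => e * (i : ℕ)

theorem J_monomial {a : ℕ} (ha : 0 < a) (s : ℕ+ →₀ ℕ) (x : ℚ) :
    ∃ y : ℚ, J (a : ℤ) (MvPolynomial.monomial s x)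
        = MvPolynomial.monomial (s - Finsupp.single a.toPNat' 1) y ∧
      (s a.toPNat' = 0 → y = 0) := by
  refine ⟨(a : ℚ) * (x * (s a.toPNat' : ℚ)), ?_, fun h => by simp [h]⟩
  simp [J, ha, MvPolynomial.pderiv_monomial, MvPolynomial.smul_monomial]

theorem weight_sub_single {s : ℕ+ →₀ ℕ} {a : ℕ} (ha : 0 < a) (h : s a.toPNat' ≠ 0) :
    weight (s - Finsupp.single a.toPNat' 1) + a = weight s := by
  have hle : Finsupp.single a.toPNat' 1 ≤ s := by
    rw [Finsupp.single_le_iff]; omega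
  have hs : s = (s - Finsupp.single a.toPNat' 1) + Finsupp.single a.toPNat' 1 :=
    (tsub_add_cancel_of_le hle).symm
  have : weight s = weight (s - Finsupp.single a.toPNat' 1)
      + weight (Finsupp.single a.toPNat' 1) := by
    conv_lhs => rw [hs]
    exact Finsupp.sum_add_index' (by simp) (by intros; ring)
  rw [this]
  have h1 : weight (Finsupp.single a.toPNat' 1) = a := by
    rw [weight, Finsupp.sum_single_index (by simp)]
    simp [Nat.toPNat'_coe, ha]
  rw [h1]

theorem prod_J_monomial (l : List ℕ) : (∀ i ∈ l, 0 < i) → ∀ (s : ℕ+ →₀ ℕ) (x : ℚ),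
    weight s < l.sum → (l.map fun i : ℕ => J (i : ℤ)).prod (MvPolynomial.monomial s x) = 0 := by
  induction l using List.reverseRecOn with
  | nil => intro _ s x h; simp at h
  | append_singleton l a ih =>
    intro hl s x h
    have ha : 0 < a := hl a (by simp)
    obtain ⟨y, hy, hy0⟩ := J_monomial ha s x
    rw [List.map_append, List.prod_append, List.map_singleton, List.prod_singleton, Module.End.mul_apply, hy]
    by_cases hs : s a.toPNat' = 0
    · simp [hy0 hs]
    · apply ih (fun i hi => hl i (by simp [hi]))
      have := weight_sub_single ha hs
      simp at h
      omega

theorem annihilators_eq_zero (f : Fock) : ∃ M : ℕ, ∀ N, M ≤ N → ∀ β : Nat.Partition N,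
    annihilators β.parts f = 0 := by
  induction f using MvPolynomial.induction_on' with
  | monomial s x =>
    refine ⟨weight s + 1, fun N hN β => ?_⟩
    apply prod_J_monomial
    · intro i hi
      exact β.parts_pos (by simpa using hi)
    · have : (β.parts.sort (· ≤ ·)).sum = N := by
        rw [← Multiset.sum_coe, Multiset.sort_eq, β.parts_sum]
      omega
  | add f g hf hg =>
    obtain ⟨M₁, h₁⟩ := hf
    obtain ⟨M₂, h₂⟩ := hg
    refine ⟨max M₁ M₂, fun N hN β => ?_⟩
    rw [map_add, h₁ N (le_trans (le_max_left _ _) hN), h₂ N (le_trans (le_max_right _ _) hN),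
      add_zero]

theorem cutJoinPart_finite (k r : ℕ) (f : Fock) :
    (Function.support fun N => cutJoinPart k r N f).Finite := by
  obtain ⟨M, hM⟩ := annihilators_eq_zero f
  refine (Set.finite_Iio M).subset fun N hN => ?_
  by_contra hlt
  apply hN
  simp [cutJoinPart, LinearMap.sum_apply, hM N (by simpa using hlt)]

/-- The `k`-leaky `r`-completed cycles cut-and-join operator `ℱ_r^k = r! [u^r] ℰ_{-k}(u)` on bosonic
Fock space, where `ℰ_n(u)` is the coefficient of `z^n` in the vertex operator
`ς(u)⁻¹ · exp (∑_{j ≥ 1} ς(uj) J_{-j} z^{-j} / j) · exp (∑_{j ≥ 1} ς(uj) J_j z^j / j)`.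
Expanding the two exponentials gives a sum over partitions `α` (created) and `β` (annihilated) with
`|α| = |β| + k`; on every polynomial only finitely many weights `|β|` contribute. -/
def cutJoin (k r : ℕ) : Module.End ℚ Fock where
  toFun f := ∑ᶠ N : ℕ, cutJoinPart k r N f
  map_add' f g := by
    simp only [map_add]
    exact finsum_add_distrib (cutJoinPart_finite k r f) (cutJoinPart_finite k r g)
  map_smul' c f := by
    simp only [map_smul, RingHom.id_apply]
    exact (smul_finsum' c (cutJoinPart_finite k r f)).symm

/-- The completed cycles `(k, r)`-leaky Hurwitz number with `b` insertions of `ℱ_r^k / r`, left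
profile `μ` and right profile `ν`:
`1 / (|Aut μ| |Aut ν|) · ⟨∏ J_{μ_i} / μ_i · (ℱ_r^k / r)^b · ∏ J_{-ν_j} / ν_j⟩`.
Connected numbers are obtained by inclusion-exclusion over the set partitions of the parts of `μ`,
so that for a one-part `μ` this is the connected number. -/
def leakyHurwitz (k r b : ℕ) (μ ν : Multiset ℕ) : ℚ :=
  1 / ((autCard μ : ℚ) * (autCard ν : ℚ)) * (1 / ((μ.prod : ℚ) * (ν.prod : ℚ))) *
    vev (annihilators μ * ((1 / (r : ℚ)) • cutJoin k r) ^ b * creators ν)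

/-- `Y`'s primitive `W_{0,1} = ∑_m lh_{0;(m)} / b! · X^m`. For `μ = (m)` and `ν = (q, …, q)` with `n`
parts, genus zero means `b (r - 1) = -2 + 1 + n`, i.e. `n = b (r - 1) + 1`, and then `m = n q + b k`
reads `m = (q (r - 1) + k) b + q`. Only the `m` of this form contribute, and they determine `b`. -/
def W01 (k r q : ℕ) : ℚ⟦X⟧ :=
  open Classical in
  PowerSeries.mk fun m =>
    if ∃ b : ℕ, m = (q * (r - 1) + k) * b + q then
      let b := (m - q) / (q * (r - 1) + k)
      leakyHurwitz k r b {m} (Multiset.replicate (b * (r - 1) + 1) q) / (b.factorial : ℚ)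
    else 0

/-- `Y(X) = dW_{0,1} / dX`. -/
def Y (k r q : ℕ) : ℚ⟦X⟧ := d⁄dX ℚ (W01 k r q)

end LeakyHurwitz

end

/-! In the Hall pairing `J a` is adjoint to multiplication by `p_a`, so the Hurwitz number is a
pairing of `p_m` with `ℱ^b p_q^n`. Each `ℱ` lowers polynomial degree by at most `r - 1`, and here
the degree must fall from `n = b (r - 1) + 1` to `1`. Hence every factor attains this bound, and
only the terms merging `r` parts into one survive.

The adjoint of these terms replaces one `p_{N+k}` by `[z^N] P^r`, where `P = ∑ p_i z^i`. It sends
`[z^{K+k}] P^{s+1}` to a scalar multiple of `[z^K] P^{s+r}`, since `P^s d(P^r)` is proportional to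
`d(P^{s+r})` (`pairing_cutJoin`). Iterating gives the product formula `leakyHurwitz_one_part`.

Put `c = k/r`, `a = q + c`, `d = r - 1`. By Lagrange inversion these products are the coefficients
of the solution of `y = φ(t y^d)`, `φ(s) = (1 - c s)^(-a/c)`, and `Y = X^(q-1) y(X^(q d + k))`
(`Y_eq_expand`). In the parameter `s = t y^d` the algebraic equation is the definition of `φ`, and
the differential equation is the logarithmic derivative of `φ`; `s` becomes `Y^(r-1) X^(r-1+k)`. -/

open PowerSeries

noncomputable section

namespace LeakyHurwitz

/-! ### Lagrange inversion for formal power series. -/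

/-- The residue of `f' / f ^ (m + 1)` for `f = X / ψ` vanishes unless `m = 0`. -/
theorem coeff_pow_mul_derivative {f ψ : ℚ⟦X⟧} (hf : f * ψ = X)
    (hψ : constantCoeff ψ = 1) (m : ℕ) :
    coeff m (ψ ^ (m + 1) * d⁄dX ℚ f) = if m = 0 then 1 else 0 := by
  have hd : d⁄dX ℚ f * ψ + f * d⁄dX ℚ ψ = 1 := by
    have := congrArg (d⁄dX ℚ) hf
    rw [Derivation.leibniz, derivative_X, smul_eq_mul, smul_eq_mul] at this
    linear_combination this
  cases m with
  | zero =>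
    have h0 : ψ ^ (0 + 1) * d⁄dX ℚ f = 1 - f * d⁄dX ℚ ψ := by linear_combination hd
    have hf0 : constantCoeff f = 0 := by
      have := congrArg constantCoeff hf
      simpa [hψ] using this
    rw [h0]; simp [hf0]
  | succ m =>
    -- Exactness of the form in coefficients: on degree `m + 1`, `X d/dX` multiplies by `m + 1`, so
    -- the two terms on the right cancel there.
    have key : ψ ^ (m + 1 + 1) * d⁄dX ℚ f
        = ψ ^ (m + 1) - PowerSeries.C (1 / ((m : ℚ) + 1)) * (X * d⁄dX ℚ (ψ ^ (m + 1))) := by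
      have h1 : PowerSeries.C (1 / ((m : ℚ) + 1)) * ((m : ℚ⟦X⟧) + 1) = 1 := by
        rw [← map_natCast (PowerSeries.C (R := ℚ)), ← map_one (PowerSeries.C (R := ℚ)), ← map_add,
          ← map_mul]
        congr 1
        field_simp
      rw [derivative_pow, Nat.add_sub_cancel]
      push_cast
      linear_combination ψ ^ (m + 1) * hd - ψ ^ m * d⁄dX ℚ ψ * hf
        + X * ψ ^ m * d⁄dX ℚ ψ * h1
    rw [key, map_sub, coeff_C_mul, coeff_succ_X_mul, coeff_derivative]
    simp
    field_simp
    simp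

theorem hasSubst_of_mul_eq_X {f ψ : ℚ⟦X⟧} (hf : f * ψ = X) (hψ : constantCoeff ψ = 1) :
    HasSubst f := by
  apply HasSubst.of_constantCoeff_zero'
  have := congrArg constantCoeff hf
  simpa [hψ] using this

theorem one_subst {f : ℚ⟦X⟧} (hs : HasSubst f) : (1 : ℚ⟦X⟧).subst f = 1 := by
  rw [← Polynomial.coe_one, subst_coe hs]; simp

theorem C_subst {f : ℚ⟦X⟧} (hs : HasSubst f) (e : ℚ) :
    (PowerSeries.C e).subst f = PowerSeries.C e := by
  rw [← Polynomial.coe_C, subst_coe hs]; simp [algebraMap_eq]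

/-- **Lagrange inversion**: the coefficients of `h` are recovered from `h ∘ (X / ψ)`. -/
theorem coeff_derivative_subst_mul_pow {f ψ : ℚ⟦X⟧} (hf : f * ψ = X) (hψ : constantCoeff ψ = 1)
    (h : ℚ⟦X⟧) (b : ℕ) :
    coeff b (d⁄dX ℚ (h.subst f) * ψ ^ (b + 1)) = (b + 1) * coeff (b + 1) h := by
  have hs := hasSubst_of_mul_eq_X hf hψ
  rw [derivative_subst hs]
  suffices H : ∀ g : ℚ⟦X⟧, coeff b (g.subst f * d⁄dX ℚ f * ψ ^ (b + 1)) = coeff b g by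
    rw [H, coeff_derivative]; ring
  intro g
  have hX : ∀ (j : ℕ), j ≤ b → coeff b (f ^ j * d⁄dX ℚ f * ψ ^ (b + 1)) = if j = b then 1 else 0 := by
    intro j hj
    obtain ⟨e, rfl⟩ := Nat.exists_eq_add_of_le hj
    have : f ^ j * d⁄dX ℚ f * ψ ^ (j + e + 1) = X ^ j * (ψ ^ (e + 1) * d⁄dX ℚ f) := by
      rw [← hf]; ring
    rw [this, Nat.add_comm j e, coeff_X_pow_mul, coeff_pow_mul_derivative hf hψ]
    simp
  -- The tail of `g` contributes a multiple of `f ^ (b + 1) * ψ ^ (b + 1) = X ^ (b + 1)`, invisible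
  -- in degree `b`; only a polynomial remains.
  rw [g.eq_X_pow_mul_shift_add_trunc (b + 1)]
  rw [subst_add hs, subst_mul hs, subst_pow hs, subst_X hs, subst_coe hs, add_mul, add_mul,
    map_add]
  have h1 : ∀ u : ℚ⟦X⟧, coeff b (f ^ (b + 1) * u * d⁄dX ℚ f * ψ ^ (b + 1)) = 0 := by
    intro u
    have : f ^ (b + 1) * u * d⁄dX ℚ f * ψ ^ (b + 1) = X ^ (b + 1) * (u * d⁄dX ℚ f) := by
      rw [← hf]; ring
    rw [this, coeff_X_pow_mul']
    simp
  rw [h1, zero_add, map_add, coeff_X_pow_mul']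
  simp only [show ¬ b + 1 ≤ b by omega, if_false, zero_add]
  rw [Polynomial.aeval_eq_sum_range' (n := b + 1) (natDegree_trunc_lt _ _), Finset.sum_mul, Finset.sum_mul,
    map_sum]
  rw [Polynomial.coeff_coe]
  rw [Finset.sum_eq_single b]
  · rw [smul_mul_assoc, smul_mul_assoc, coeff_smul, hX b le_rfl]; simp
  · intro j hj hjb
    rw [smul_mul_assoc, smul_mul_assoc, coeff_smul, hX j (by simp at hj; omega)]; simp [hjb]
  · simp

/-- The functionals are triangular: on `D = X ^ n * u`, the `n`-th one returns the constant term of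
`u`. -/
theorem eq_zero_of_coeff_mul_pow {D ψ : ℚ⟦X⟧} (hψ : constantCoeff ψ = 1)
    (hD : ∀ b, coeff b (D * ψ ^ (b + 1)) = 0) : D = 0 := by
  by_contra hne
  obtain ⟨n, u, hu⟩ : ∃ n u, D = X ^ n * u ∧ constantCoeff u ≠ 0 := by
    refine ⟨D.order.toNat, D.divXPowOrder, (X_pow_order_mul_divXPowOrder).symm, ?_⟩
    exact (constantCoeff_divXPowOrder_eq_zero_iff).not.mpr hne
  have := hD n
  rw [hu.1, mul_assoc] at this
  have h2 := coeff_X_pow_mul (u * ψ ^ (n + 1)) n 0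
  rw [zero_add] at h2
  rw [h2] at this
  simp [hψ] at this
  exact hu.2 this

theorem subst_injective_of_mul_eq_X {f ψ : ℚ⟦X⟧} (hf : f * ψ = X) (hψ : constantCoeff ψ = 1)
    {u v : ℚ⟦X⟧} (h : u.subst f = v.subst f) : u = v := by
  have hs := hasSubst_of_mul_eq_X hf hψ
  have h0 : constantCoeff f = 0 := by
    have := congrArg constantCoeff hf
    simpa [hψ] using this
  have hw : (u - v).subst f = 0 := by rw [subst_sub hs, h, sub_self]
  rw [← sub_eq_zero]
  ext n
  cases n with
  | zero =>
    have : (u - v - PowerSeries.C (constantCoeff (u - v))).subst f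
      = - PowerSeries.C (constantCoeff (u - v)) := by
      rw [subst_sub hs, hw, ← Polynomial.coe_C, subst_coe hs]
      simp [algebraMap_eq]
    have h2 := congrArg constantCoeff this
    have h3 : constantCoeff ((u - v - PowerSeries.C (constantCoeff (u - v))).subst f) = 0 :=
      constantCoeff_subst_eq_zero h0 _ (by simp)
    rw [h3] at h2
    simp at h2 ⊢
    linarith
  | succ b =>
    have := coeff_derivative_subst_mul_pow hf hψ (u - v) b
    rw [hw] at this
    simp only [map_zero, zero_mul] at this
    have hb : (b : ℚ) + 1 ≠ 0 := by positivity
    simpa [hb] using this.symm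

/-! ### Binomial-type series and the tree series. -/

/-- The rising product `∏_{i < j} (x + c i) / j!`, a coefficient of `(1 - c s) ^ (-x / c)`. -/
def risingCoeff (c x : ℚ) (j : ℕ) : ℚ := (∏ i ∈ Finset.range j, (x + c * i)) / j.factorial

theorem risingCoeff_succ (c x : ℚ) (j : ℕ) :
    (j + 1) * risingCoeff c x (j + 1) = (x + c * j) * risingCoeff c x j := by
  have : (j.factorial : ℚ) ≠ 0 := by positivity
  rw [risingCoeff, risingCoeff, Finset.prod_range_succ, Nat.factorial_succ]
  push_cast
  field_simp

theorem coeff_eq_risingCoeff {c x : ℚ} {F : ℚ⟦X⟧} (h0 : constantCoeff F = 1)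
    (hF : (1 - PowerSeries.C c * X) * d⁄dX ℚ F = PowerSeries.C x * F) (j : ℕ) :
    coeff j F = risingCoeff c x j := by
  induction j with
  | zero => simp [risingCoeff, h0]
  | succ j ih =>
    have hj : (j : ℚ) + 1 ≠ 0 := by positivity
    have h1 := congrArg (coeff j) hF
    have h2 : (1 - PowerSeries.C c * X) * d⁄dX ℚ F = d⁄dX ℚ F - PowerSeries.C c * (X * d⁄dX ℚ F) := by
      ring
    have h3 : coeff j (X * d⁄dX ℚ F) = j * coeff j F := by
      cases j with
      | zero => simp
      | succ j => rw [coeff_succ_X_mul, coeff_derivative]; push_cast; ring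
    rw [h2, map_sub, coeff_C_mul, coeff_C_mul, h3, coeff_derivative] at h1
    apply mul_left_cancel₀ hj
    rw [risingCoeff_succ, ← ih]
    linear_combination h1

/-- The series `(1 - c s) ^ (-x / c)`, which is `exp (x s)` for `c = 0`. -/
def risingSeries (c x : ℚ) : ℚ⟦X⟧ := PowerSeries.mk (risingCoeff c x)

@[simp] theorem constantCoeff_risingSeries (c x : ℚ) : constantCoeff (risingSeries c x) = 1 := by
  rw [← coeff_zero_eq_constantCoeff_apply, risingSeries, coeff_mk]
  simp [risingCoeff]

theorem derivative_risingSeries (c x : ℚ) :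
    (1 - PowerSeries.C c * X) * d⁄dX ℚ (risingSeries c x) = PowerSeries.C x * risingSeries c x := by
  ext j
  have h2 : (1 - PowerSeries.C c * X) * d⁄dX ℚ (risingSeries c x)
      = d⁄dX ℚ (risingSeries c x) - PowerSeries.C c * (X * d⁄dX ℚ (risingSeries c x)) := by
    ring
  have h3 : coeff j (X * d⁄dX ℚ (risingSeries c x)) = j * risingCoeff c x j := by
    cases j with
    | zero => simp
    | succ j => rw [coeff_succ_X_mul, coeff_derivative, risingSeries, coeff_mk]; push_cast; ring
  rw [h2, map_sub, coeff_C_mul, coeff_C_mul, h3, coeff_derivative, risingSeries, coeff_mk, coeff_mk]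
  linear_combination risingCoeff_succ c x j

theorem coeff_risingSeries_pow (c x : ℚ) (n j : ℕ) :
    coeff j (risingSeries c x ^ n) = risingCoeff c (n * x) j := by
  apply coeff_eq_risingCoeff
  · simp
  · rw [derivative_pow]
    cases n with
    | zero => simp
    | succ n =>
      rw [Nat.add_sub_cancel, map_mul, map_natCast]
      linear_combination ((n + 1 : ℕ) : ℚ⟦X⟧) * risingSeries c x ^ n * derivative_risingSeries c x

/-- The solution `y` of `y = φ (t y ^ d)`, `φ = risingSeries c a`, by Lagrange inversion. -/
def treeSeries (c a : ℚ) (d : ℕ) : ℚ⟦X⟧ :=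
  PowerSeries.mk fun b => risingCoeff c (((b * d + 1 : ℕ) : ℚ) * a) b / ((b * d + 1 : ℕ) : ℚ)

section
variable (c a : ℚ) (d : ℕ)

theorem X_mul_inv_mul_risingSeries_pow :
    (X * (risingSeries c a ^ d)⁻¹) * risingSeries c a ^ d = X := by
  rw [mul_assoc, PowerSeries.inv_mul_cancel _ (by simp), mul_one]

/-- Derivatives are compared through the triangular functionals. With `n = (b + 1) d + 1`, `φ'
φ^((b+1)d)` is `(φ^n)' / n`, whose coefficients are rising products. -/
theorem treeSeries_subst :
    (treeSeries c a d).subst (X * (risingSeries c a ^ d)⁻¹) = risingSeries c a := by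
  set φ := risingSeries c a with hφ
  have hf := X_mul_inv_mul_risingSeries_pow c a d
  have hψ : constantCoeff (risingSeries c a ^ d) = 1 := by simp
  have hs := hasSubst_of_mul_eq_X hf hψ
  set f := X * (φ ^ d)⁻¹ with hfdef
  rw [← hφ] at hf hψ
  apply derivative.ext
  · rw [← sub_eq_zero]
    apply eq_zero_of_coeff_mul_pow hψ
    intro b
    rw [sub_mul, map_sub, coeff_derivative_subst_mul_pow hf hψ]
    have hn : (((b + 1) * d + 1 : ℕ) : ℚ) ≠ 0 := by positivity
    have h1 : PowerSeries.C ((((b + 1) * d + 1 : ℕ) : ℚ)) * (d⁄dX ℚ φ * (φ ^ d) ^ (b + 1))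
        = d⁄dX ℚ (φ ^ ((b + 1) * d + 1)) := by
      rw [derivative_pow, Nat.add_sub_cancel, map_natCast]
      ring
    have h2 := congrArg (coeff b) h1
    rw [coeff_C_mul, coeff_derivative, hφ, coeff_risingSeries_pow, ← hφ] at h2
    rw [treeSeries, coeff_mk]
    field_simp
    linear_combination -h2
  · have h0 : constantCoeff (treeSeries c a d - 1) = 0 := by
      rw [map_sub, ← coeff_zero_eq_constantCoeff_apply, treeSeries, coeff_mk]
      simp [risingCoeff]
    have h1 : constantCoeff ((treeSeries c a d - 1).subst f) = 0 :=
      constantCoeff_subst_eq_zero (show constantCoeff f = 0 by simp [hfdef]) _ h0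
    rw [subst_sub hs, one_subst hs, map_sub, sub_eq_zero] at h1
    simpa [hφ] using h1

theorem treeSeries_functional_subst :
    (X * treeSeries c a d ^ d).subst (X * (risingSeries c a ^ d)⁻¹) = (X : ℚ⟦X⟧) := by
  have hf := X_mul_inv_mul_risingSeries_pow c a d
  have hs := hasSubst_of_mul_eq_X hf (by simp)
  rw [subst_mul hs, subst_pow hs, subst_X hs, treeSeries_subst, hf]

/-- After substitution the left side is `φ^κ (1 - c s)^(ρ+κ)`, of logarithmic derivative zero
exactly by `h`. Stating `h` without dividing by `c` admits the exponential case `c = 0`. -/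
theorem treeSeries_algebraic (ρ κ : ℕ) (h : κ * a = c * (ρ + κ)) :
    treeSeries c a d ^ κ * (1 - PowerSeries.C c * (X * treeSeries c a d ^ d)) ^ (ρ + κ) = 1 := by
  have hf := X_mul_inv_mul_risingSeries_pow c a d
  have hs := hasSubst_of_mul_eq_X hf (by simp)
  apply subst_injective_of_mul_eq_X hf (by simp)
  rw [subst_mul hs, subst_pow hs, subst_pow hs, subst_sub hs, subst_mul hs (PowerSeries.C c),
    treeSeries_functional_subst, treeSeries_subst, one_subst hs, C_subst hs]
  have hne : (1 - PowerSeries.C c * X : ℚ⟦X⟧) ≠ 0 := by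
    intro h0
    simpa using congrArg constantCoeff h0
  apply derivative.ext
  · apply mul_left_cancel₀ hne
    rw [derivative_one, mul_zero, Derivation.leibniz, smul_eq_mul, smul_eq_mul, derivative_pow,
      derivative_pow, map_sub, derivative_one, Derivation.leibniz, derivative_C, derivative_X]
    have hd := derivative_risingSeries c a
    have hk : (κ : ℚ⟦X⟧) * PowerSeries.C a = PowerSeries.C c * (ρ + κ) := by
      rw [← map_natCast (PowerSeries.C (R := ℚ)), ← map_natCast (PowerSeries.C (R := ℚ)), ← map_add,
        ← map_mul, ← map_mul, h]
    have e1 : (1 - PowerSeries.C c * X : ℚ⟦X⟧) * (((ρ + κ : ℕ) : ℚ⟦X⟧)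
        * (1 - PowerSeries.C c * X) ^ (ρ + κ - 1))
        = ((ρ + κ : ℕ) : ℚ⟦X⟧) * (1 - PowerSeries.C c * X) ^ (ρ + κ) := by
      rcases Nat.eq_zero_or_pos (ρ + κ) with h0 | h0
      · simp [h0]
      · obtain ⟨e, he⟩ := Nat.exists_eq_add_of_le' h0
        rw [he, Nat.add_sub_cancel]; ring
    have e2 : (1 - PowerSeries.C c * X : ℚ⟦X⟧) * (((κ : ℕ) : ℚ⟦X⟧)
        * risingSeries c a ^ (κ - 1) * d⁄dX ℚ (risingSeries c a))
        = κ * PowerSeries.C a * risingSeries c a ^ κ := by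
      rcases Nat.eq_zero_or_pos κ with h0 | h0
      · simp [h0]
      · obtain ⟨e, he⟩ := Nat.exists_eq_add_of_le' h0
        rw [he, Nat.add_sub_cancel]
        linear_combination ((e + 1 : ℕ) : ℚ⟦X⟧) * risingSeries c a ^ e * hd
    push_cast at e1 e2 ⊢
    simp only [smul_eq_mul, mul_one, mul_zero, add_zero, zero_sub]
    linear_combination -PowerSeries.C c * risingSeries c a ^ κ * e1
      + (1 - PowerSeries.C c * X) ^ (ρ + κ) * e2
      + risingSeries c a ^ κ * (1 - PowerSeries.C c * X) ^ (ρ + κ) * hk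
  · simp

theorem treeSeries_ode :
    (1 - PowerSeries.C (c + d * a) * (X * treeSeries c a d ^ d)) * (X * d⁄dX ℚ (treeSeries c a d))
      = PowerSeries.C a * (X * treeSeries c a d ^ d) * treeSeries c a d := by
  have hf := X_mul_inv_mul_risingSeries_pow c a d
  have hs := hasSubst_of_mul_eq_X hf (by simp)
  apply subst_injective_of_mul_eq_X hf (by simp)
  rw [subst_mul hs, subst_mul hs X (d⁄dX ℚ (treeSeries c a d)), subst_sub hs,
    subst_mul hs (PowerSeries.C _), subst_mul hs _ (treeSeries c a d), subst_mul hs (PowerSeries.C _), subst_X hs,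
    treeSeries_functional_subst, treeSeries_subst, one_subst hs, C_subst hs, C_subst hs]
  have hφ := derivative_subst (f := treeSeries c a d) hs
  rw [treeSeries_subst] at hφ
  set f := X * (risingSeries c a ^ d)⁻¹
  set φ := risingSeries c a with hφdef
  have hd : d⁄dX ℚ f * φ ^ d + f * d⁄dX ℚ (φ ^ d) = 1 := by
    have := congrArg (d⁄dX ℚ) hf
    rw [Derivation.leibniz, derivative_X, smul_eq_mul, smul_eq_mul] at this
    linear_combination this
  have hf0 : constantCoeff f = 0 := by simp [f]
  -- This factor clears the denominators of `φ'/φ`, of `f`, and of the chain rule `(y' ∘ f) f' =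
  -- φ'`.
  have hne : (1 - PowerSeries.C c * X) * φ ^ d * d⁄dX ℚ f ≠ 0 := by
    intro h0
    have e0 := congrArg constantCoeff h0
    have e1 := congrArg constantCoeff hd
    simp [hφdef, hf0] at e0 e1
    simp [e0] at e1
  have hu := derivative_risingSeries c a
  have hv : (1 - PowerSeries.C c * X) * d⁄dX ℚ (φ ^ d) = (d : ℚ⟦X⟧) * PowerSeries.C a * φ ^ d := by
    rw [derivative_pow]
    rcases Nat.eq_zero_or_pos d with h0 | h0
    · simp [h0]
    · obtain ⟨e, he⟩ := Nat.exists_eq_add_of_le' h0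
      rw [he, Nat.add_sub_cancel]
      linear_combination ((e + 1 : ℕ) : ℚ⟦X⟧) * φ ^ e * hu
  rw [← hφdef] at hu
  apply mul_left_cancel₀ hne
  rw [map_add PowerSeries.C, map_mul PowerSeries.C, map_natCast PowerSeries.C]
  linear_combination -(1 - (PowerSeries.C c + (d : ℚ⟦X⟧) * PowerSeries.C a) * X) * f * φ ^ d
        * (1 - PowerSeries.C c * X) * hφ
    + (1 - (PowerSeries.C c + (d : ℚ⟦X⟧) * PowerSeries.C a) * X) * f * φ ^ d * hu
    + (1 - (PowerSeries.C c + (d : ℚ⟦X⟧) * PowerSeries.C a) * X) * PowerSeries.C a * φ * hf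
    - PowerSeries.C a * X * φ * (1 - PowerSeries.C c * X) * hd
    + PowerSeries.C a * X * φ * f * hv
    + PowerSeries.C a * X * φ * ((d : ℚ⟦X⟧) * PowerSeries.C a) * hf

end

/-! ### The Hall pairing and the adjointness of creation and annihilation. -/

/-- The power sum `p_a`, as an element of Fock space. -/
def pvar (a : ℕ) : Fock := MvPolynomial.X a.toPNat'

theorem J_natCast {a : ℕ} (ha : 0 < a) (g : Fock) :
    J (a : ℤ) g = (a : ℚ) • MvPolynomial.pderiv a.toPNat' g := by
  simp [J, ha]

theorem J_neg_natCast {a : ℕ} (ha : 0 < a) (g : Fock) : J (-(a : ℤ)) g = pvar a * g := by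
  have h : ¬ 0 < -(a : ℤ) := by omega
  have h' : -(a : ℤ) < 0 := by omega
  simp only [J, h, h', if_false, if_true, pvar]
  simp

theorem creators_apply {s : Multiset ℕ} (hs : ∀ i ∈ s, 0 < i) (g : Fock) :
    creators s g = (s.map pvar).prod * g := by
  have H : ∀ l : List ℕ, (∀ i ∈ l, 0 < i) →
      (l.map fun i : ℕ => J (-(i : ℤ))).prod g = (l.map pvar).prod * g := by
    intro l
    induction l with
    | nil => simp
    | cons a l ih =>
      intro hl
      simp only [List.mem_cons, forall_eq_or_imp] at hl
      simp only [List.map_cons, List.prod_cons, Module.End.mul_apply]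
      rw [ih hl.2, J_neg_natCast hl.1, mul_assoc]
  rw [creators, H _ (by simpa using hs), ← Multiset.prod_coe, ← Multiset.map_coe, Multiset.sort_eq]

/-- The norm `∏ i ^ e_i e_i!` of the monomial with exponents `e_i`. -/
def monoNorm (s : ℕ+ →₀ ℕ) : ℚ := s.prod fun i e => (i : ℚ) ^ e * e.factorial

theorem monoNorm_add_single (s : ℕ+ →₀ ℕ) (i : ℕ+) :
    monoNorm (s + Finsupp.single i 1) = i * (s i + 1) * monoNorm s := by
  rw [monoNorm, monoNorm, ← Finsupp.mul_prod_erase' (s + Finsupp.single i 1) i _ (by simp),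
    ← Finsupp.mul_prod_erase' s i _ (by simp), Finsupp.erase_add, Finsupp.erase_single, add_zero]
  simp only [Finsupp.add_apply, Finsupp.single_eq_same, Nat.factorial_succ]
  push_cast
  ring

/-- The Hall inner product on Fock space. -/
def pairing : Fock →ₗ[ℚ] Fock →ₗ[ℚ] ℚ :=
  (MvPolynomial.basisMonomials ℕ+ ℚ).constr ℚ fun s => monoNorm s • MvPolynomial.lcoeff ℚ s

theorem pairing_monomial (s : ℕ+ →₀ ℕ) (x : ℚ) (g : Fock) :
    pairing (MvPolynomial.monomial s x) g = x * (monoNorm s * MvPolynomial.coeff s g) := by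
  have h : (MvPolynomial.monomial s x : Fock) = x • MvPolynomial.basisMonomials ℕ+ ℚ s := by
    simp [MvPolynomial.smul_monomial]
  rw [h, map_smul, pairing, Module.Basis.constr_basis]
  simp [MvPolynomial.lcoeff]

theorem pairing_comm (f g : Fock) : pairing f g = pairing g f := by
  induction f using MvPolynomial.induction_on' with
  | add f₁ f₂ h₁ h₂ => rw [map_add, map_add, LinearMap.add_apply, h₁, h₂]
  | monomial s x =>
    induction g using MvPolynomial.induction_on' with
    | add g₁ g₂ h₁ h₂ => rw [map_add, map_add, LinearMap.add_apply, h₁, h₂]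
    | monomial t y =>
      rw [pairing_monomial, pairing_monomial, MvPolynomial.coeff_monomial,
        MvPolynomial.coeff_monomial]
      by_cases h : s = t
      · subst h; simp; ring
      · simp [h, Ne.symm h]

theorem pairing_pvar_mul {a : ℕ} (ha : 0 < a) (f g : Fock) :
    pairing (pvar a * f) g = pairing f (J (a : ℤ) g) := by
  induction f using MvPolynomial.induction_on' with
  | add f₁ f₂ h₁ h₂ => rw [mul_add, map_add, map_add, LinearMap.add_apply, LinearMap.add_apply, h₁, h₂]
  | monomial s x =>
    have h : pvar a * MvPolynomial.monomial s x
        = MvPolynomial.monomial (s + Finsupp.single a.toPNat' 1) x := by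
      rw [pvar, MvPolynomial.X, MvPolynomial.monomial_mul, one_mul, add_comm]
    rw [h, J_natCast ha, pairing_monomial, pairing_monomial, monoNorm_add_single,
      MvPolynomial.coeff_smul, MvPolynomial.coeff_pderiv, Nat.toPNat'_coe, if_pos ha,
      smul_eq_mul]
    ring

theorem pairing_mul_pvar {a : ℕ} (ha : 0 < a) (f g : Fock) :
    pairing f (pvar a * g) = pairing (J (a : ℤ) f) g := by
  rw [pairing_comm, pairing_pvar_mul ha, pairing_comm]

theorem pairing_one (g : Fock) : pairing 1 g = MvPolynomial.constantCoeff g := by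
  have : (1 : Fock) = MvPolynomial.monomial 0 1 := rfl
  rw [this, pairing_monomial]
  simp [monoNorm, MvPolynomial.constantCoeff_eq]

theorem pairing_annihilators {s : Multiset ℕ} (hs : ∀ i ∈ s, 0 < i) (f g : Fock) :
    pairing f (annihilators s g) = pairing ((s.map pvar).prod * f) g := by
  have H : ∀ l : List ℕ, (∀ i ∈ l, 0 < i) → ∀ f : Fock,
      pairing f ((l.map fun i : ℕ => J (i : ℤ)).prod g) = pairing ((l.map pvar).prod * f) g := by
    intro l
    induction l with
    | nil => simp
    | cons a l ih =>
      intro hl f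
      simp only [List.mem_cons, forall_eq_or_imp] at hl
      simp only [List.map_cons, List.prod_cons, Module.End.mul_apply]
      rw [← pairing_pvar_mul hl.1, ih hl.2]
      congr 2; ring
  rw [annihilators, H _ (by simpa using hs), ← Multiset.prod_coe, ← Multiset.map_coe,
    Multiset.sort_eq]

/-! ### The degree filtration on Fock space. -/

/-- Polynomials without monomials of degree less than `d`. -/
def lowDeg (d : ℕ) : Submodule ℚ Fock where
  carrier := {f | ∀ s : ℕ+ →₀ ℕ, s.degree < d → MvPolynomial.coeff s f = 0}
  add_mem' hf hg s hs := by rw [MvPolynomial.coeff_add, hf s hs, hg s hs, add_zero]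
  zero_mem' s _ := by simp
  smul_mem' c f hf s hs := by rw [MvPolynomial.coeff_smul, hf s hs, smul_zero]

theorem lowDeg_mono {d e : ℕ} (h : d ≤ e) : lowDeg e ≤ lowDeg d :=
  fun _ hf s hs => hf s (hs.trans_le h)

theorem mem_lowDeg_zero (f : Fock) : f ∈ lowDeg 0 := fun s hs => by simp at hs

theorem pvar_mul_mem_lowDeg {d : ℕ} {f : Fock} (hf : f ∈ lowDeg d) (a : ℕ) :
    pvar a * f ∈ lowDeg (d + 1) := by
  classical
  intro s hs
  rw [pvar, MvPolynomial.coeff_X_mul']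
  split_ifs with h
  · apply hf
    have hle : Finsupp.single a.toPNat' 1 ≤ s := by
      rw [Finsupp.single_le_iff]
      have := Finsupp.mem_support_iff.mp h
      omega
    have h2 := congrArg Finsupp.degree (tsub_add_cancel_of_le hle)
    rw [map_add, Finsupp.degree_single] at h2
    omega
  · rfl

theorem J_mem_lowDeg {d : ℕ} {f : Fock} (hf : f ∈ lowDeg d) {a : ℕ} (ha : 0 < a) :
    J (a : ℤ) f ∈ lowDeg (d - 1) := by
  rw [J_natCast ha]
  apply Submodule.smul_mem
  intro s hs
  rw [MvPolynomial.coeff_pderiv, hf, zero_mul]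
  rw [map_add, Finsupp.degree_single]
  omega

theorem creators_mem_lowDeg {s : Multiset ℕ} (hs : ∀ i ∈ s, 0 < i) {d : ℕ} {f : Fock}
    (hf : f ∈ lowDeg d) : creators s f ∈ lowDeg (d + s.card) := by
  rw [creators_apply hs]
  clear hs
  induction s using Multiset.induction_on with
  | empty => simpa using hf
  | cons a s ih =>
    rw [Multiset.map_cons, Multiset.prod_cons, mul_assoc, Multiset.card_cons, ← add_assoc]
    exact pvar_mul_mem_lowDeg ih a

theorem annihilators_mem_lowDeg {s : Multiset ℕ} (hs : ∀ i ∈ s, 0 < i) {d : ℕ} {f : Fock}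
    (hf : f ∈ lowDeg d) : annihilators s f ∈ lowDeg (d - s.card) := by
  have H : ∀ l : List ℕ, (∀ i ∈ l, 0 < i) →
      (l.map fun i : ℕ => J (i : ℤ)).prod f ∈ lowDeg (d - l.length) := by
    intro l
    induction l with
    | nil => simpa using hf
    | cons a l ih =>
      intro hl
      simp only [List.mem_cons, forall_eq_or_imp] at hl
      simp only [List.map_cons, List.prod_cons, Module.End.mul_apply, List.length_cons]
      exact lowDeg_mono (by omega) (J_mem_lowDeg (ih hl.2) hl.1)
  have := H (s.sort (· ≤ ·)) (by simpa using hs)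
  rwa [Multiset.length_sort] at this

/-! ### Powers of the power-sum generating series. -/

/-- The generating series `∑ p_i z ^ i` of the power sums. -/
def powerSumSeries : PowerSeries Fock := PowerSeries.mk fun i => if i = 0 then 0 else pvar i

/-- The coefficient of `z ^ M` in the `s`-th power of the series `∑ p_i z ^ i`. -/
def powCoeff (s M : ℕ) : Fock := coeff M (powerSumSeries ^ s)

/-- `powCoeff s M` is homogeneous of degree `s`, and monomials of different degree are orthogonal.
-/
theorem pairing_powCoeff_of_mem_lowDeg (s : ℕ) : ∀ (M : ℕ) {g : Fock}, g ∈ lowDeg (s + 1) →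
    pairing (powCoeff s M) g = 0 := by
  induction s with
  | zero =>
    intro M g hg
    rw [powCoeff, pow_zero, coeff_one]
    split_ifs
    · rw [pairing_one, MvPolynomial.constantCoeff_eq]
      exact hg 0 (by simp)
    · simp
  | succ s ih =>
    intro M g hg
    rw [powCoeff, pow_succ', coeff_mul, map_sum, LinearMap.sum_apply]
    apply Finset.sum_eq_zero
    rintro ⟨i, j⟩ -
    simp only [powerSumSeries, coeff_mk]
    split_ifs with h
    · simp
    · rw [pairing_pvar_mul (Nat.pos_of_ne_zero h)]
      exact ih j (J_mem_lowDeg hg (Nat.pos_of_ne_zero h))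

/-- `∂/∂p_j` is a derivation coefficientwise in `z` and sends `∑ p_i z^i` to `z^j`. -/
theorem J_powCoeff_succ {j : ℕ} (hj : 0 < j) (s M : ℕ) :
    J (j : ℤ) (powCoeff (s + 1) M)
      = if j ≤ M then (((s + 1 : ℕ) : ℚ) * j) • powCoeff s (M - j) else 0 := by
  have hD : ∀ F G : PowerSeries Fock,
      PowerSeries.mk (fun n => MvPolynomial.pderiv j.toPNat' (coeff n (F * G)))
        = F * PowerSeries.mk (fun n => MvPolynomial.pderiv j.toPNat' (coeff n G))
        + G * PowerSeries.mk (fun n => MvPolynomial.pderiv j.toPNat' (coeff n F)) := by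
    intro F G
    ext1 n
    rw [mul_comm G, coeff_mk, map_add, coeff_mul, coeff_mul, coeff_mul, map_sum,
      ← Finset.sum_add_distrib]
    refine Finset.sum_congr rfl fun x _ => ?_
    rw [Derivation.leibniz, coeff_mk, coeff_mk, smul_eq_mul, smul_eq_mul]
    ring
  have h1 : PowerSeries.mk (fun n => MvPolynomial.pderiv j.toPNat' (coeff n powerSumSeries))
      = X ^ j := by
    ext1 n
    rw [coeff_mk, coeff_X_pow, powerSumSeries, coeff_mk]
    split_ifs with h0 h1 h1
    · omega
    · simp
    · subst h1; simp [pvar]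
    · rw [pvar, MvPolynomial.pderiv_X_of_ne]
      intro h2
      have := congrArg PNat.val h2
      simp [Nat.pos_of_ne_zero h0, hj] at this
      exact h1 this
  have hpow : ∀ s : ℕ, PowerSeries.mk (fun n => MvPolynomial.pderiv j.toPNat'
      (coeff n (powerSumSeries ^ (s + 1)))) = (s + 1 : ℕ) • (X ^ j * powerSumSeries ^ s) := by
    intro s
    induction s with
    | zero => simp [h1]
    | succ s ih =>
      rw [pow_succ, hD, h1, ih]
      simp only [nsmul_eq_mul]
      push_cast
      ring
  have h2 := congrArg (coeff M) (hpow s)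
  rw [coeff_mk, map_nsmul, coeff_X_pow_mul'] at h2
  rw [J_natCast hj, powCoeff, h2]
  split_ifs
  · rw [← Nat.cast_smul_eq_nsmul ℚ, smul_smul, mul_comm]; rfl
  · simp

/-- Coefficient of `z^K` in `(s + r) P^s z (P^r)' = r z (P^(s+r))'`, plus `k (s + r)` times that of
`P^r P^s = P^(s+r)`. -/
theorem sum_powCoeff_mul_powCoeff {r : ℕ} (hr : 0 < r) (s K : ℕ) (k : ℚ) :
    (s + r : ℚ) • ∑ x ∈ Finset.HasAntidiagonal.antidiagonal K, (x.1 + k) • (powCoeff r x.1 * powCoeff s x.2)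
      = (r * K + k * (s + r)) • powCoeff (s + r) K := by
  obtain ⟨r, rfl⟩ : ∃ r', r = r' + 1 := ⟨r - 1, by omega⟩
  have h1 : ((s + (r + 1) : ℕ) : PowerSeries Fock) *
        (X * d⁄dX Fock (powerSumSeries ^ (r + 1)) * powerSumSeries ^ s)
      = ((r + 1 : ℕ) : PowerSeries Fock) * (X * d⁄dX Fock (powerSumSeries ^ (s + (r + 1)))) := by
    rw [derivative_pow, derivative_pow, ← add_assoc, Nat.add_sub_cancel, Nat.add_sub_cancel]
    ring
  have hX : ∀ F : PowerSeries Fock, ∀ n, coeff n (X * d⁄dX Fock F) = (n : ℚ) • coeff n F := by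
    intro F n
    cases n with
    | zero => simp
    | succ n =>
      rw [coeff_succ_X_mul, coeff_derivative, Nat.cast_smul_eq_nsmul, nsmul_eq_mul]
      push_cast
      ring
  have h2 := congrArg (coeff K) h1
  rw [← nsmul_eq_mul, ← nsmul_eq_mul, map_nsmul, map_nsmul, hX, coeff_mul,
    ← Nat.cast_smul_eq_nsmul ℚ, ← Nat.cast_smul_eq_nsmul ℚ, smul_smul] at h2
  have h3 : powCoeff (s + (r + 1)) K
      = ∑ x ∈ Finset.HasAntidiagonal.antidiagonal K, powCoeff (r + 1) x.1 * powCoeff s x.2 := by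
    rw [powCoeff, add_comm, pow_add, coeff_mul]
    rfl
  have h4 : ∑ x ∈ Finset.HasAntidiagonal.antidiagonal K,
        ((x.1 : ℚ) + k) • (powCoeff (r + 1) x.1 * powCoeff s x.2)
      = ∑ x ∈ Finset.HasAntidiagonal.antidiagonal K,
          coeff x.1 (X * d⁄dX Fock (powerSumSeries ^ (r + 1))) * coeff x.2 (powerSumSeries ^ s)
        + k • powCoeff (s + (r + 1)) K := by
    rw [h3, Finset.smul_sum, ← Finset.sum_add_distrib]
    refine Finset.sum_congr rfl fun x _ => ?_
    rw [hX, smul_mul_assoc, add_smul]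
    rfl
  rw [h4, smul_add, smul_smul]
  push_cast at h2 ⊢
  rw [h2, add_smul, powCoeff, mul_comm k]

/-! ### Leading order in `u` of the cut-and-join coefficients. -/

theorem coeff_one_varsigma (a : ℚ) : coeff 1 (varsigma a) = a := by
  simp [varsigma, coeff_rescale, coeff_exp]

theorem constantCoeff_varsigma (a : ℚ) : constantCoeff (varsigma a) = 0 := by
  rw [← coeff_zero_eq_constantCoeff_apply, varsigma, map_sub, coeff_rescale, coeff_rescale]
  simp

theorem constantCoeff_calS : constantCoeff calS = 1 := by
  rw [← coeff_zero_eq_constantCoeff_apply, calS, coeff_mk, zero_add, coeff_one_varsigma]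

theorem exists_prod_varsigma {s : Multiset ℕ} (hs : ∀ i ∈ s, 0 < i) :
    ∃ u : ℚ⟦X⟧, constantCoeff u = 1 ∧
      (s.map fun i : ℕ => PowerSeries.C (1 / (i : ℚ)) * varsigma (i : ℚ)).prod = X ^ s.card * u := by
  induction s using Multiset.induction_on with
  | empty => exact ⟨1, by simp, by simp⟩
  | cons a s ih =>
    obtain ⟨u, hu, h⟩ := ih fun i hi => hs i (Multiset.mem_cons_of_mem hi)
    have ha : (a : ℚ) ≠ 0 := by
      have := hs a (Multiset.mem_cons_self a s)
      positivity
    obtain ⟨v, hv⟩ := X_dvd_iff.mpr (constantCoeff_varsigma a)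
    have hv1 : constantCoeff v = a := by
      have := coeff_one_varsigma a
      rw [hv, show (1 : ℕ) = 0 + 1 from rfl, coeff_succ_X_mul] at this
      simpa using this
    refine ⟨PowerSeries.C (1 / (a : ℚ)) * v * u, by simp [hu, hv1, ha], ?_⟩
    rw [Multiset.map_cons, Multiset.prod_cons, h, hv, Multiset.card_cons]
    ring

theorem exists_cutJoinCoeff_eq (r : ℕ) {α β : Multiset ℕ} (hα : ∀ i ∈ α, 0 < i)
    (hβ : ∀ i ∈ β, 0 < i) : ∃ u : ℚ⟦X⟧, constantCoeff u = 1 ∧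
    cutJoinCoeff r α β = (r.factorial : ℚ) / ((autCard α : ℚ) * (autCard β : ℚ)) *
      coeff (r + 1) (X ^ (α.card + β.card) * u) := by
  obtain ⟨u, hu, h1⟩ := exists_prod_varsigma hα
  obtain ⟨v, hv, h2⟩ := exists_prod_varsigma hβ
  refine ⟨calS⁻¹ * u * v, by simp [hu, hv, constantCoeff_calS], ?_⟩
  rw [cutJoinCoeff, h1, h2]
  congr 2
  ring

theorem cutJoinCoeff_eq_zero {r : ℕ} {α β : Multiset ℕ} (hα : ∀ i ∈ α, 0 < i)
    (hβ : ∀ i ∈ β, 0 < i) (h : r + 1 < α.card + β.card) : cutJoinCoeff r α β = 0 := by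
  obtain ⟨u, -, hc⟩ := exists_cutJoinCoeff_eq r hα hβ
  rw [hc, coeff_X_pow_mul', if_neg (by omega), mul_zero]

theorem cutJoinCoeff_singleton {r a : ℕ} {β : Multiset ℕ} (ha : 0 < a)
    (hβ : ∀ i ∈ β, 0 < i) (h : β.card = r) :
    cutJoinCoeff r {a} β = (r.factorial : ℚ) / (autCard β : ℚ) := by
  obtain ⟨u, hu, hc⟩ := exists_cutJoinCoeff_eq r (α := {a}) (by simpa using ha) hβ
  rw [hc, coeff_X_pow_mul', if_pos (by simp; omega)]
  simp [h, add_comm, hu, autCard]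

theorem partition_pos {N : ℕ} (α : Nat.Partition N) : ∀ i ∈ α.parts, 0 < i :=
  fun _ hi => α.parts_pos hi

/-- Rules out terms that annihilate parts and create none, which could lower the degree by more than
`r - 1`. -/
theorem parts_eq_zero_of_card_eq_zero {k N : ℕ} (α : Nat.Partition (N + k)) (β : Nat.Partition N)
    (h : α.parts.card = 0) : β.parts.card = 0 := by
  have h1 := α.parts_sum
  rw [Multiset.card_eq_zero.mp h, Multiset.sum_zero] at h1
  have h2 : N = 0 := by omega
  subst h2
  simp

theorem powCoeff_zero_right {r : ℕ} (hr : 0 < r) : powCoeff r 0 = 0 := by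
  rw [powCoeff, coeff_zero_eq_constantCoeff_apply, map_pow, ← coeff_zero_eq_constantCoeff_apply,
    powerSumSeries, coeff_mk]
  simp [hr.ne']

theorem countPerms_mul_autCard (s : Multiset ℕ) : s.countPerms * autCard s = s.card.factorial := by
  have := Nat.multinomial_spec s.toFinset (fun i => s.count i)
  rw [Multiset.toFinset_sum_count_eq] at this
  rw [mul_comm, ← this, autCard]
  rfl

/-- The multinomial expansion of a power of `∑ p_i z ^ i`, indexed by partitions. -/
theorem powCoeff_eq_sum_partition (r N : ℕ) :
    powCoeff r N = ∑ β : Nat.Partition N, if β.parts.card = r then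
      ((r.factorial : ℚ) / (autCard β.parts : ℚ)) • (β.parts.map pvar).prod else 0 := by
  -- Parts larger than `N` cannot contribute to `z^N`, so a finite multinomial expansion suffices.
  have htr : ((trunc (N + 1) powerSumSeries : Polynomial Fock) : PowerSeries Fock)
      = ∑ i ∈ Finset.Icc 1 N, PowerSeries.monomial i (pvar i) := by
    ext1 n
    rw [Polynomial.coeff_coe, coeff_trunc, map_sum]
    simp only [coeff_monomial, powerSumSeries, coeff_mk, Finset.sum_ite_eq, Finset.mem_Icc]
    split_ifs <;> first | rfl | omega
  have h1 : powCoeff r N = coeff N ((∑ i ∈ Finset.Icc 1 N, PowerSeries.monomial i (pvar i)) ^ r) := by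
    rw [← htr, powCoeff, ← coeff_coe_trunc_of_lt (Nat.lt_succ_self N),
      ← coeff_coe_trunc_of_lt (Nat.lt_succ_self N) (f := _ ^ r), trunc_trunc_pow]
  have hprod : ∀ s : Multiset ℕ, (s.map fun i => PowerSeries.monomial i (pvar i)).prod
      = PowerSeries.monomial s.sum (s.map pvar).prod := by
    intro s
    induction s using Multiset.induction_on with
    | empty => simp
    | cons a s ih => simp [ih, monomial_mul_monomial]
  rw [h1, Finset.sum_pow, map_sum, ← Finset.sum_filter]
  simp only [hprod, ← nsmul_eq_mul, map_nsmul, coeff_monomial, smul_ite, smul_zero]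
  rw [← Finset.sum_filter]
  symm
  refine Finset.sum_bij (fun β hβ => Sym.mk β.parts (Finset.mem_filter.mp hβ).2) ?_ ?_ ?_ ?_
  · intro β hβ
    simp only [Finset.mem_filter, Finset.mem_sym_iff, Finset.mem_Icc]
    refine ⟨fun a ha => ⟨β.parts_pos ha, β.le_of_mem_parts ha⟩, β.parts_sum.symm⟩
  · intro β _ γ _ h
    exact Nat.Partition.ext (congrArg Subtype.val h)
  · intro s hs
    simp only [Finset.mem_filter, Finset.mem_sym_iff, Finset.mem_Icc] at hs
    refine ⟨⟨s.1, fun {i} hi => (hs.1 i hi).1, hs.2.symm⟩, ?_, rfl⟩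
    exact Finset.mem_filter.mpr ⟨Finset.mem_univ _, s.2⟩
  · intro β hβ
    have hc := (Finset.mem_filter.mp hβ).2
    have h2 := countPerms_mul_autCard β.parts
    rw [hc] at h2
    have h3 : (autCard β.parts : ℚ) ≠ 0 := by
      rw [Nat.cast_ne_zero, autCard, Finset.prod_ne_zero_iff]
      exact fun i _ => Nat.factorial_ne_zero _
    rw [← h2, ← Nat.cast_smul_eq_nsmul ℚ]
    congr 1
    push_cast
    field_simp

/-! ### The adjoint action of the cut-and-join operator on top-degree terms. -/

theorem cutJoin_term_mem_lowDeg {k r N d e : ℕ} (α : Nat.Partition (N + k)) (β : Nat.Partition N)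
    {g : Fock} (hg : g ∈ lowDeg e)
    (h : α.parts.card + β.parts.card ≤ r + 1 → (α.parts.card = 0 → β.parts.card = 0) →
      d ≤ e - β.parts.card + α.parts.card) :
    (cutJoinCoeff r α.parts β.parts • (creators α.parts * annihilators β.parts)) g ∈ lowDeg d := by
  rw [LinearMap.smul_apply, Module.End.mul_apply]
  by_cases hc : α.parts.card + β.parts.card ≤ r + 1
  · apply Submodule.smul_mem
    exact lowDeg_mono (h hc (parts_eq_zero_of_card_eq_zero α β))
      (creators_mem_lowDeg (partition_pos α) (annihilators_mem_lowDeg (partition_pos β) hg))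
  · rw [cutJoinCoeff_eq_zero (partition_pos α) (partition_pos β) (by omega), zero_smul]
    exact Submodule.zero_mem _

theorem cutJoin_mem_lowDeg (k : ℕ) {r d : ℕ} (hr : 0 < r) {g : Fock}
    (hg : g ∈ lowDeg (d + (r - 1))) : cutJoin k r g ∈ lowDeg d := by
  change ∑ᶠ N : ℕ, cutJoinPart k r N g ∈ lowDeg d
  refine finsum_induction (· ∈ lowDeg d) (Submodule.zero_mem _)
    (fun _ _ => Submodule.add_mem _) fun N => ?_
  rw [cutJoinPart, LinearMap.sum_apply]
  refine Submodule.sum_mem _ fun α _ => ?_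
  rw [LinearMap.sum_apply]
  refine Submodule.sum_mem _ fun β _ => cutJoin_term_mem_lowDeg α β hg fun h1 h2 => ?_
  omega

/-- Against a power sum coefficient of degree `s`, only the terms of the cut-and-join operator
merging `r` parts into one contribute. -/
theorem pairing_cutJoinPart {k r s : ℕ} (hr : 0 < r) (hkr : 0 < k ∨ 2 ≤ r) (hs : 0 < s)
    (M N : ℕ) {g : Fock} (hg : g ∈ lowDeg (s + (r - 1))) :
    pairing (powCoeff s M) (cutJoinPart k r N g)
      = pairing (powCoeff r N * J ((N + k : ℕ) : ℤ) (powCoeff s M)) g := by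
  have hvan : ∀ (α : Nat.Partition (N + k)) (β : Nat.Partition N),
      ¬ (α.parts.card = 1 ∧ β.parts.card = r) → pairing (powCoeff s M)
        ((cutJoinCoeff r α.parts β.parts • (creators α.parts * annihilators β.parts)) g) = 0 := by
    intro α β hαβ
    apply pairing_powCoeff_of_mem_lowDeg
    apply cutJoin_term_mem_lowDeg α β hg
    intro h1 h2
    by_cases h3 : α.parts.card = 0
    · have h4 := h2 h3
      -- The scalar term with `α` and `β` empty occurs only for `k = 0`. It preserves degree, so it
      -- is negligible once `r - 1 > 0`: this is the use of `(k, r) ≠ (0, 1)`.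
      have h5 : 2 ≤ r := by
        rcases hkr with hk | h
        · have h6 := α.parts_sum
          rw [Multiset.card_eq_zero.mp h3, Multiset.sum_zero] at h6
          omega
        · exact h
      omega
    · omega
  rw [cutJoinPart, LinearMap.sum_apply, map_sum]
  simp only [LinearMap.sum_apply, map_sum]
  by_cases h0 : N + k = 0
  · have hN : N = 0 := by omega
    subst hN
    rw [powCoeff_zero_right hr, zero_mul, map_zero, LinearMap.zero_apply]
    refine Finset.sum_eq_zero fun α _ => Finset.sum_eq_zero fun β _ => hvan α β ?_
    rintro ⟨-, h⟩
    simp at h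
    omega
  · rw [Finset.sum_eq_single (Nat.Partition.indiscrete (N + k))]
    · rw [powCoeff_eq_sum_partition r N, Finset.sum_mul, map_sum, LinearMap.sum_apply]
      refine Finset.sum_congr rfl fun β _ => ?_
      split_ifs with hβ
      · rw [Nat.Partition.indiscrete_parts h0,
          cutJoinCoeff_singleton (Nat.pos_of_ne_zero h0) (partition_pos β) hβ,
          LinearMap.smul_apply, Module.End.mul_apply, map_smul,
          creators_apply (by simpa using Nat.pos_of_ne_zero h0), Multiset.map_singleton,
          Multiset.prod_singleton, pairing_mul_pvar (Nat.pos_of_ne_zero h0),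
          pairing_annihilators (partition_pos β), smul_mul_assoc, map_smul, LinearMap.smul_apply]
      · rw [zero_mul, map_zero, LinearMap.zero_apply]
        exact hvan _ β fun h => hβ h.2
    · intro α _ hα
      refine Finset.sum_eq_zero fun β _ => hvan α β ?_
      rintro ⟨h, -⟩
      apply hα
      obtain ⟨a, ha⟩ := Multiset.card_eq_one.mp h
      apply Nat.Partition.ext
      have h1 := α.parts_sum
      rw [ha, Multiset.sum_singleton] at h1
      rw [Nat.Partition.indiscrete_parts h0, ha, h1]
    · simp

theorem pairing_cutJoin {k r s : ℕ} (hr : 0 < r) (hkr : 0 < k ∨ 2 ≤ r) (K : ℕ) {g : Fock}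
    (hg : g ∈ lowDeg (s + 1 + (r - 1))) :
    (s + r : ℚ) * pairing (powCoeff (s + 1) (K + k)) (cutJoin k r g)
      = (s + 1) * (r * K + k * (s + r)) * pairing (powCoeff (s + r) K) g := by
  have h1 : pairing (powCoeff (s + 1) (K + k)) (cutJoin k r g)
      = ∑ᶠ N : ℕ, pairing (powCoeff (s + 1) (K + k)) (cutJoinPart k r N g) :=
    (pairing (powCoeff (s + 1) (K + k))).toAddMonoidHom.map_finsum (cutJoinPart_finite k r g)
  have hterm : ∀ N, pairing (powCoeff (s + 1) (K + k)) (cutJoinPart k r N g)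
      = if N ≤ K then pairing (((s + 1 : ℚ)) • ((N : ℚ) + k) •
          (powCoeff r N * powCoeff s (K - N))) g else 0 := by
    intro N
    rw [pairing_cutJoinPart hr hkr s.succ_pos _ _ hg]
    by_cases h0 : N + k = 0
    · have hN : N = 0 := by omega
      subst hN
      simp [powCoeff_zero_right hr]
    · rw [J_powCoeff_succ (Nat.pos_of_ne_zero h0), Nat.add_sub_add_right]
      simp only [add_le_add_iff_right]
      split_ifs
      · rw [mul_smul_comm, smul_smul]; push_cast; rfl
      · simp
  rw [h1, finsum_eq_sum_of_support_subset (s := Finset.range (K + 1))]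
  · rw [Finset.sum_congr rfl fun N hN => (hterm N).trans
      (if_pos (Nat.lt_succ_iff.mp (Finset.mem_range.mp hN)))]
    rw [← LinearMap.sum_apply, ← map_sum, ← Finset.smul_sum,
      ← Finset.Nat.sum_antidiagonal_eq_sum_range_succ_mk
        (fun x : ℕ × ℕ => ((x.1 : ℚ) + k) • (powCoeff r x.1 * powCoeff s x.2)),
      map_smul, LinearMap.smul_apply, smul_eq_mul, mul_left_comm, ← smul_eq_mul (s + r : ℚ),
      ← LinearMap.smul_apply, ← map_smul, sum_powCoeff_mul_powCoeff hr, map_smul,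
      LinearMap.smul_apply, smul_eq_mul, mul_assoc]
  · intro N hN
    rw [Function.mem_support, hterm] at hN
    simp only [Finset.coe_range, Set.mem_Iio]
    by_contra h
    exact hN (if_neg (by omega))

theorem cutJoin_pow_mem_lowDeg (k d b : ℕ) : ∀ (e : ℕ) {g : Fock}, g ∈ lowDeg (e + b * d) →
    (cutJoin k (d + 1) ^ b) g ∈ lowDeg e := by
  induction b with
  | zero => intro e g hg; simpa using hg
  | succ b ih =>
    intro e g hg
    rw [pow_succ', Module.End.mul_apply]
    refine cutJoin_mem_lowDeg k d.succ_pos (ih _ ?_)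
    rw [Nat.succ_sub_one]
    convert hg using 2
    ring

/-- The start `i` is kept general for the induction: moving one operator across raises `i` by one.
The ratios `(i d + 1) / ((i + 1) d + 1)` telescope, leaving one linear factor per operator. -/
theorem pairing_cutJoin_pow {k d : ℕ} (hkr : 0 < k ∨ 2 ≤ d + 1) (M : ℕ) (b : ℕ) :
    ∀ (i : ℕ) {g : Fock}, g ∈ lowDeg ((i + b) * d + 1) →
    (((i + b) * d + 1 : ℕ) : ℚ) *
        pairing (powCoeff (i * d + 1) (M + k * b)) ((cutJoin k (d + 1) ^ b) g)
      = (i * d + 1) * (∏ j ∈ Finset.range b, ((d + 1) * (M + k * (b + i)) - k * (i + j) : ℚ))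
        * pairing (powCoeff ((i + b) * d + 1) M) g := by
  induction b with
  | zero => intro i g _; simp
  | succ b ih =>
    intro i g hg
    have e1 : i + (b + 1) = i + 1 + b := by ring
    have hmem : (cutJoin k (d + 1) ^ b) g ∈ lowDeg (i * d + 1 + (d + 1 - 1)) := by
      apply cutJoin_pow_mem_lowDeg
      convert hg using 2
      rw [Nat.add_sub_cancel]
      ring
    have h1 := pairing_cutJoin d.succ_pos hkr (M + k * b) hmem
    have h2 := ih (i + 1) (e1 ▸ hg)
    have e2 : i * d + (d + 1) = (i + 1) * d + 1 := by ring
    rw [Nat.succ_eq_add_one, e2] at h1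
    rw [pow_succ', Module.End.mul_apply, Finset.prod_range_succ', e1,
      show M + k * (b + 1) = M + k * b + k by ring]
    have h3 : ∏ j ∈ Finset.range b, ((d + 1) * (M + k * (b + (i + 1 : ℕ))) - k * ((i + 1 : ℕ) + j) : ℚ)
        = ∏ j ∈ Finset.range b,
          ((d + 1) * (M + k * ((b + 1 : ℕ) + i)) - k * (i + (j + 1 : ℕ)) : ℚ) := by
      refine Finset.prod_congr rfl fun j _ => ?_
      push_cast
      ring
    rw [h3] at h2
    have hne : (i * d + (d + 1 : ℕ) : ℚ) ≠ 0 := by positivity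
    apply mul_left_cancel₀ hne
    push_cast at h1 h2 ⊢
    linear_combination ((i + 1 + b) * d + 1 : ℚ) * h1
      + (i * d + 1) * ((d + 1) * (M + k * b) + k * (i * d + (d + 1)) : ℚ) * h2

/-! ### The closed formula and the identification of `Y`. -/

theorem pairing_powCoeff_pvar_pow {q : ℕ} (hq : 0 < q) (n : ℕ) :
    pairing (powCoeff n (q * n)) (pvar q ^ n) = n.factorial * (q : ℚ) ^ n := by
  induction n with
  | zero => simp [powCoeff, pairing_one]
  | succ n ih =>
    rw [pow_succ', pairing_mul_pvar hq, J_powCoeff_succ hq, if_pos (Nat.le_mul_of_pos_right q n.succ_pos),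
      Nat.mul_succ, Nat.add_sub_cancel, map_smul, LinearMap.smul_apply, ih, Nat.factorial_succ, smul_eq_mul]
    push_cast
    ring

theorem pvar_pow_mem_lowDeg (q n : ℕ) : pvar q ^ n ∈ lowDeg n := by
  induction n with
  | zero => exact mem_lowDeg_zero _
  | succ n ih =>
    rw [pow_succ']
    exact pvar_mul_mem_lowDeg ih q

theorem vev_J_mul {m : ℕ} (hm : 0 < m) (T : Module.End ℚ Fock) :
    vev (annihilators {m} * T) = pairing (powCoeff 1 m) (T 1) := by
  have h : powCoeff 1 m = pvar m * 1 := by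
    simp [powCoeff, powerSumSeries, hm.ne']
  rw [h, pairing_pvar_mul hm, pairing_one, vev, annihilators, Multiset.sort_singleton]
  simp

/-- The closed formula for the one-part genus-zero leaky Hurwitz numbers. -/
theorem leakyHurwitz_one_part {k d q : ℕ} (hkr : 0 < k ∨ 2 ≤ d + 1) (hq : 0 < q) (b : ℕ) :
    leakyHurwitz k (d + 1) b {q * (b * d + 1) + k * b} (Multiset.replicate (b * d + 1) q)
      = (∏ j ∈ Finset.range b, ((q * (b * d + 1) + k * b : ℚ) - k / (d + 1) * j))
        / ((b * d + 1) * (q * (b * d + 1) + k * b)) := by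
  set n := b * d + 1 with hn
  set m := q * n + k * b with hm
  have hm0 : 0 < m := by positivity
  have haut : autCard (Multiset.replicate n q) = n.factorial := by
    rw [autCard, Multiset.toFinset_replicate, if_neg (by omega)]
    simp
  have hv : vev (annihilators {m} * ((1 / ((d + 1 : ℕ) : ℚ)) • cutJoin k (d + 1)) ^ b
      * creators (Multiset.replicate n q))
      = (1 / ((d + 1 : ℕ) : ℚ)) ^ b
        * pairing (powCoeff 1 m) ((cutJoin k (d + 1) ^ b) (pvar q ^ n)) := by
    rw [mul_assoc, vev_J_mul hm0, Module.End.mul_apply,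
      creators_apply (fun i hi => (Multiset.eq_of_mem_replicate hi) ▸ hq), smul_pow,
      LinearMap.smul_apply, map_smul, smul_eq_mul, Multiset.map_replicate, Multiset.prod_replicate,
      mul_one]
  have hp := pairing_cutJoin_pow hkr (q * n) b 0 (g := pvar q ^ n)
    (by rw [zero_add]; exact pvar_pow_mem_lowDeg q n)
  rw [zero_add, zero_mul, zero_add, ← hn, ← hm, pairing_powCoeff_pvar_pow hq] at hp
  have hn0 : (n : ℚ) ≠ 0 := by positivity
  have hf0 : (n.factorial : ℚ) ≠ 0 := by positivity
  have hq0 : (q : ℚ) ≠ 0 := by positivity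
  have hmq : (m : ℚ) ≠ 0 := by positivity
  have hd0 : (d + 1 : ℚ) ≠ 0 := by positivity
  have hprod : ∏ j ∈ Finset.range b, ((d + 1) * ((q * n : ℕ) + k * (b + (0 : ℕ))) - k * ((0 : ℕ) + j) : ℚ)
      = (d + 1) ^ b * ∏ j ∈ Finset.range b, ((m : ℚ) - k / (d + 1) * j) := by
    rw [show (d + 1 : ℚ) ^ b = ∏ _j ∈ Finset.range b, (d + 1 : ℚ) by simp,
      ← Finset.prod_mul_distrib]
    refine Finset.prod_congr rfl fun j _ => ?_
    rw [hm]
    push_cast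
    field_simp
    ring
  rw [hprod] at hp
  have hm' : (q * (b * d + 1) + k * b : ℚ) = m := by rw [hm, hn]; push_cast; ring
  have hn' : (b * d + 1 : ℚ) = n := by rw [hn]; push_cast; ring
  rw [hm', hn', leakyHurwitz, hv, haut]
  have hP : pairing (powCoeff 1 m) ((cutJoin k (d + 1) ^ b) (pvar q ^ n))
      = (d + 1) ^ b * (∏ j ∈ Finset.range b, ((m : ℚ) - k / (d + 1) * j))
        * (n.factorial * q ^ n) / n := by
    rw [eq_div_iff hn0]
    push_cast at hp
    linear_combination hp
  rw [hP]
  simp [autCard]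
  field_simp

theorem leakyHurwitz_eq_coeff_treeSeries {k d q : ℕ} (hkr : 0 < k ∨ 2 ≤ d + 1) (hq : 0 < q)
    (b : ℕ) :
    leakyHurwitz k (d + 1) b {q * (b * d + 1) + k * b} (Multiset.replicate (b * d + 1) q)
        / b.factorial * (q * (b * d + 1) + k * b)
      = coeff b (treeSeries (k / (d + 1)) (q + k / (d + 1)) d) := by
  have hn0 : (b * d + 1 : ℚ) ≠ 0 := by positivity
  have hm0 : (q * (b * d + 1) + k * b : ℚ) ≠ 0 := by positivity
  have hf0 : (b.factorial : ℚ) ≠ 0 := by positivity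
  have hd0 : (d + 1 : ℚ) ≠ 0 := by positivity
  have hprod : ∏ j ∈ Finset.range b, ((q * (b * d + 1) + k * b : ℚ) - k / (d + 1) * j)
      = ∏ j ∈ Finset.range b, ((b * d + 1) * (q + k / (d + 1)) + k / (d + 1) * j : ℚ) := by
    -- Reversing `j ↦ b - 1 - j` turns the falling product from `m` into a rising one from `n a`, as
    -- `m - c (b - 1) = n (q + c)`.
    rw [← Finset.prod_range_reflect]
    refine Finset.prod_congr rfl fun j hj => ?_
    have hj' := Finset.mem_range.mp hj
    rw [Nat.sub_sub, Nat.cast_sub (by omega)]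
    push_cast
    field_simp
    ring
  rw [leakyHurwitz_one_part hkr hq, hprod, treeSeries, coeff_mk, risingCoeff]
  push_cast
  field_simp

/-- Differentiating `W01` supplies the factor `m = j + 1` and shifts exponents to `m - 1 = (q - 1) +
(q d + k) b`. -/
theorem Y_eq_expand {k d q : ℕ} (hkr : 0 < k ∨ 2 ≤ d + 1) (hq : 0 < q)
    (hM : q * d + k ≠ 0) :
    Y k (d + 1) q
      = X ^ (q - 1) * expand (q * d + k) hM (treeSeries (k / (d + 1)) (q + k / (d + 1)) d) := by
  ext j
  rw [Y, coeff_derivative, W01, coeff_mk, coeff_X_pow_mul', Nat.add_sub_cancel]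
  by_cases h : ∃ b : ℕ, j + 1 = (q * d + k) * b + q
  · obtain ⟨b, hb⟩ := h
    have h1 : (j + 1 - q) / (q * d + k) = b := by
      rw [hb, Nat.add_sub_cancel, Nat.mul_div_cancel_left b (Nat.pos_of_ne_zero hM)]
    have h2 : j - (q - 1) = (q * d + k) * b := by omega
    rw [if_pos ⟨b, hb⟩, if_pos (by omega), h1, h2, coeff_expand_mul,
      ← leakyHurwitz_eq_coeff_treeSeries hkr hq]
    have h3 : j + 1 = q * (b * d + 1) + k * b := by rw [hb]; ring
    have h4 : (j : ℚ) + 1 = q * (b * d + 1) + k * b := by exact_mod_cast h3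
    rw [h4, h3]
  · rw [if_neg h, zero_mul]
    split_ifs with h1
    · rw [coeff_expand_of_not_dvd]
      rintro ⟨b, hb⟩
      exact h ⟨b, by omega⟩
    · rfl

theorem X_mul_derivative_expand {M : ℕ} (hM : M ≠ 0) (F : ℚ⟦X⟧) :
    X * d⁄dX ℚ (expand M hM F) = (M : ℚ⟦X⟧) * expand M hM (X * d⁄dX ℚ F) := by
  rw [map_mul, expand_X, expand_apply, expand_apply, derivative_subst (HasSubst.X_pow hM),
    derivative_pow, derivative_X]
  obtain ⟨e, rfl⟩ := Nat.exists_eq_succ_of_ne_zero hM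
  rw [Nat.succ_sub_one, Nat.succ_eq_add_one]
  ring

end LeakyHurwitz

end

/-! ### Transfer from the tree series to `Y`. -/

theorem mainTheorem9 (k r q : ℕ) (hr : 0 < r) (hq : 0 < q) (hkr : 0 < k ∨ 2 ≤ r)
    (g ρ κ : ℕ) (hg : g = Nat.gcd (q * r) k) (hρ : ρ = q * r / g) (hκ : κ = k / g)
    (Y T : PowerSeries ℚ) (hY : Y = LeakyHurwitz.Y k r q)
    (hT : T = Y ^ (r - 1) * PowerSeries.X ^ (r - 1 + k)) :
    Y ≠ 0 ∧
    PowerSeries.X ^ ((q - 1) * κ)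
      = Y ^ κ * (1 - PowerSeries.C ((k : ℚ) / (r : ℚ)) * T) ^ (ρ + κ) ∧
    (1 - PowerSeries.C ((q : ℚ) * ((r : ℚ) - 1) + (k : ℚ)) * T)
        * (PowerSeries.X * PowerSeries.derivative ℚ Y)
      = (PowerSeries.C ((q : ℚ) - 1)
          + PowerSeries.C (((q : ℚ) * ((r : ℚ) - 1) + (k : ℚ)) * ((r : ℚ) + (k : ℚ)) / (r : ℚ)) * T)
        * Y := by
  obtain ⟨d, rfl⟩ : ∃ d, r = d + 1 := ⟨r - 1, by omega⟩
  obtain ⟨p, rfl⟩ : ∃ p, q = p + 1 := ⟨q - 1, by omega⟩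
  have hM : (p + 1) * d + k ≠ 0 := by
    rcases hkr with h | h
    · omega
    · have : 0 < (p + 1) * d := Nat.mul_pos p.succ_pos (by omega)
      omega
  rw [LeakyHurwitz.Y_eq_expand hkr hq hM, Nat.add_sub_cancel] at hY
  have hd0 : (d + 1 : ℚ) ≠ 0 := by positivity
  set c : ℚ := k / (d + 1) with hc
  set a : ℚ := (p + 1 : ℕ) + c with ha
  set y := LeakyHurwitz.treeSeries c a d with hy
  set E := expand ((p + 1) * d + k) hM (R := ℚ) with hE
  have hy0 : constantCoeff y = 1 := by
    rw [← coeff_zero_eq_constantCoeff_apply, hy, LeakyHurwitz.treeSeries, coeff_mk]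
    simp [LeakyHurwitz.risingCoeff]
  -- Exponent count: `(q - 1) d + d + k = q d + k`.
  have hTE : T = E (X * y ^ d) := by
    rw [hT, hY, Nat.add_sub_cancel, map_mul, map_pow, hE, expand_X]
    ring
  have hEC : ∀ x : ℚ, E (PowerSeries.C x) = PowerSeries.C x := expand_C _ hM
  refine ⟨?_, ?_, ?_⟩
  · rw [hY]
    refine mul_ne_zero (pow_ne_zero _ X_ne_zero) fun h => ?_
    have := congrArg constantCoeff h
    rw [hE, constantCoeff_expand, hy0] at this
    simp at this
  · have hgpos : 0 < g := by
      rw [hg]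
      exact Nat.gcd_pos_of_pos_left _ (Nat.mul_pos p.succ_pos d.succ_pos)
    have h1 : κ * ((p + 1) * (d + 1)) = k * ρ := by
      rw [hκ, hρ, ← Nat.mul_div_assoc _ (hg ▸ Nat.gcd_dvd_left _ _), mul_comm,
        ← Nat.mul_div_assoc _ (hg ▸ Nat.gcd_dvd_right _ _), mul_comm]
    have h1q : (κ : ℚ) * ((p + 1) * (d + 1)) = k * ρ := by exact_mod_cast h1
    have h2 : κ * a = c * (ρ + κ) := by
      rw [ha, hc]
      push_cast
      field_simp
      linear_combination h1q
    have h3 := congrArg E (LeakyHurwitz.treeSeries_algebraic c a d ρ κ h2)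
    rw [map_mul, map_pow, map_pow, map_sub, map_one, map_mul E (PowerSeries.C c), hEC, ← hy, ← hTE]
      at h3
    rw [hY, Nat.add_sub_cancel, Nat.cast_succ, ← hc, mul_pow, mul_assoc, h3, mul_one, pow_mul]
  · have h1 := congrArg E (LeakyHurwitz.treeSeries_ode c a d)
    rw [map_mul, map_sub, map_one, map_mul E (PowerSeries.C _), map_mul E _ (LeakyHurwitz.treeSeries c a d),
      map_mul E (PowerSeries.C a), hEC, hEC, ← hy, ← hTE] at h1
    have h2 := LeakyHurwitz.X_mul_derivative_expand hM y
    rw [← hE] at h2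
    have h3 : X * d⁄dX ℚ Y = (p : ℚ⟦X⟧) * Y
        + X ^ p * ((((p + 1) * d + k : ℕ) : ℚ⟦X⟧) * E (X * d⁄dX ℚ y)) := by
      rw [← h2, hY, Derivation.leibniz, derivative_pow, derivative_X, smul_eq_mul, smul_eq_mul]
      cases p with
      | zero => simp
      | succ p => rw [Nat.add_sub_cancel]; ring
    have e1 : c + d * a = (((p + 1) * d + k : ℕ) : ℚ) := by
      rw [ha, hc]; push_cast; field_simp; ring
    have e2 : (((p + 1 : ℕ) : ℚ) * (((d + 1 : ℕ) : ℚ) - 1) + k) = (((p + 1) * d + k : ℕ) : ℚ) := by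
      push_cast; ring
    -- Since `a - (q - 1) = 1 + k / r`; the shift by `q - 1` comes from differentiating the
    -- prefactor `X^(q-1)`.
    have e3 : (((p + 1) * d + k : ℕ) : ℚ) * (((d + 1 : ℕ) : ℚ) + k) / ((d + 1 : ℕ) : ℚ)
        = (((p + 1) * d + k : ℕ) : ℚ) * (a - p) := by
      rw [ha, hc]; push_cast; field_simp; ring
    have e4 : ((p + 1 : ℕ) : ℚ) - 1 = (p : ℕ) := by push_cast; ring
    rw [e1, map_natCast PowerSeries.C] at h1
    rw [e2, e3, e4, h3, map_mul PowerSeries.C, map_sub PowerSeries.C, map_natCast PowerSeries.C, map_natCast PowerSeries.C]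
    linear_combination X ^ p * (((p + 1) * d + k : ℕ) : ℚ⟦X⟧) * h1
      - (((p + 1) * d + k : ℕ) : ℚ⟦X⟧) * PowerSeries.C a * T * hY
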